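/- Let $G$ be an infinite group with a finite generating set $S$, and let $\Gamma=\mathrm{Cay}(G,S)$ be its (simplicial) Cayley graph: vertex set $G$, and distinct $v,w$ are adjacent iff $v=ws$ for some $s\in S\cup S^{-1}$. Let $d_S$ be the word metric, $d_S(g,h)=\min\{n\ge 0: h=gs_1\cdots s_n,\ s_i\in S\cup S^{-1}\}$. *Percolation.* For $p\in[0,1]$ let $\mathbb P_p$ be the law of Bernoulli bond percolation on $\Gamma$ (each edge is kept independently with probability $p$), let $C(g)$ be the connected component of $g$ in the resulting random graph, and put $\tau_p(g,h)=\mathbb P_p(g\leftrightarrow h)$, $\chi_p=\mathbb E_p[\#C(id)]$ and $p_c=\inf\{p\in[0,1]:\mathbb P_p(\#C(id)=\infty)>0\}$. *Barriers.* For $A,B,C\subseteq G$, the set $B$ is a $d_S$-barrier between $A$ and $C$ if every path $(g_0,\dots,g_n)$ in $\Gamma$ with $g_0\in A$ and $g_n\in C$ has some $g_i\in B$ (paths with $n=0$ are included). *Roughly branching sets.* $B\subseteq G$ is $r$-roughly branching if there is $B'\subseteq G$ such that every element of $B$ is at $d_S$-distance at most $r$ from $B'$, and such that for every $k\ge1$,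 any two distinct sequences $(g_1,\dots,g_k)\ne(h_1,\dots,h_k)$ of elements of $B'$ satisfy $g_1\cdots g_k\ne h_1\cdots h_k$. **Theorem.** Suppose that there are $r>0$ and, for all integers $D,E\ge1$, pairwise disjoint sets $S_{D;i}\subseteq G$ ($i\ge1$) with union $S_D=\bigsqcup_{i\ge1}S_{D;i}$, a set $\mathcal G_{D,E}\subseteq G$, and a collection $\mathscr H_D$ of subsets of $G$ such that for all $D,E\ge 1$: 1. $S_D$ is $r'$-roughly branching for some $r'=r'_D$; 2. for each $\mathcal H\in\mathscr H_D$ there is an $r$-roughly branching set $B=B_1\sqcup\dots\sqcup B_D\subseteq G$ such that each $B_i$ ($1\le i\le D$) is a $d_S$-barrier between $\{id\}$ and $\mathcal H$; 3. $\bigsqcup_{i\ge E}S_{D;i}$ is a $d_S$-barrier between $\{id\}$ and $\mathcal G_{D,E}$. Suppose moreover that for every $\epsilon>0$ and all integers $D,E\ge1$ there is a constant $N=N(\epsilon,D,E)$ such that every finite set $A\subseteq G$ has a subset $A'\subseteq A$ satisfying 1. $\#A'\ge(1-\epsilon)\,\#A$; 2. for each $a\in A'$ there are $\mathcal H_1,\mathcal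 H_2\in\mathscr H_D$ with $$\#\bigl(A\setminus a\cdot(\mathcal H_1\cup\mathcal H_2\cup\mathcal G_{D,E})\bigr)\le N.$$ Then $$\lim_{p\nearrow p_c}\ \sup\left\{\frac{\sum_{g,h\in A}\tau_p(g,h)}{\chi_p\cdot\#A}\;:\;A\subseteq G\text{ finite and non-empty}\right\}=0.$$ -/

import Mathlib

open MeasureTheory ProbabilityTheory Filter Topology
open scoped unitInterval ENNReal Pointwise

noncomputable section

namespace Percolation

/-! ### Bernoulli bond percolation on a simple graph -/

section Graph

variable {V : Type*} (Γ : SimpleGraph V)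

/-- Percolation configurations: each edge of `Γ` is open (`true`) or closed (`false`). -/
abbrev Config : Type _ := Γ.edgeSet → Bool

/-- The random subgraph `Γ(ω)`, obtained from `Γ` by deleting the closed edges. -/
def openGraph (ω : Config Γ) : SimpleGraph V :=
  SimpleGraph.fromEdgeSet {e | ∃ h : e ∈ Γ.edgeSet, ω ⟨e, h⟩ = true}

/-- The law `ℙ_p`: edges are open independently, each with probability `p`. -/
def bondMeasure (p : I) : Measure (Config Γ) :=
  Measure.infinitePi fun _ : Γ.edgeSet => bernoulliMeasure true false p

/-- The cluster (connected component) of `v` in `Γ(ω)`. -/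
def cluster (ω : Config Γ) (v : V) : Set V :=
  {w | (openGraph Γ ω).Reachable v w}

/-- The two-point function `τ_p(v, w) = ℙ_p(v ↔ w)`. -/
def twoPoint (p : I) (v w : V) : ℝ≥0∞ :=
  bondMeasure Γ p {ω | (openGraph Γ ω).Reachable v w}

/-- The expected number of vertices of the cluster of `v`, as an element of `[0, ∞]`. -/
def expectedClusterSize (p : I) (v : V) : ℝ≥0∞ :=
  ∫⁻ ω, ((cluster Γ ω v).encard : ℝ≥0∞) ∂(bondMeasure Γ p)

/-- The critical parameter, with root vertex `v`: the infimum, in the complete lattice `[0, 1]`,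
of those `p` for which the cluster of `v` is infinite with positive probability. -/
def criticalParameter (v : V) : I :=
  sInf {p : I | 0 < bondMeasure Γ p {ω | (cluster Γ ω v).Infinite}}

end Graph

/-! ### Cayley graphs, word metrics, barriers and roughly branching sets -/

section Group

variable {G : Type*} [Group G]

/-- The (simplicial) Cayley graph: `v ≠ w` are adjacent iff `v = w s` for some `s ∈ S ∪ S⁻¹`. -/
abbrev cayley (S : Finset G) : SimpleGraph G := SimpleGraph.mulCayley (S : Set G)

/-- The word metric `d_S(g, h)`: the least `n` for which `h = g s₁ ⋯ sₙ` with all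
`sᵢ ∈ S ∪ S⁻¹`. -/
def wordDist (S : Finset G) (g h : G) : ℕ :=
  sInf {n : ℕ | ∃ l : List G, l.length = n ∧ (∀ s ∈ l, s ∈ S ∨ s⁻¹ ∈ S) ∧ h = g * l.prod}

/-- `B` is a `d_S`-barrier between `A` and `C`: every path of the Cayley graph which starts in `A`
and ends in `C` meets `B`. Paths may revisit vertices and may have length zero. -/
def IsBarrier (S : Finset G) (B A C : Set G) : Prop :=
  ∀ a ∈ A, ∀ c ∈ C, ∀ γ : (cayley S).Walk a c, ∃ g ∈ γ.support, g ∈ B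

/-- `B` is `r`-roughly branching: it lies in the `r`-neighborhood of a set `B'` such that, for
every `k ≥ 1`, distinct sequences of length `k` in `B'` have distinct products. -/
def IsRoughlyBranching (S : Finset G) (r : ℝ) (B : Set G) : Prop :=
  ∃ B' : Set G,
    (∀ b ∈ B, ∃ b' ∈ B', (wordDist S b' b : ℝ) ≤ r) ∧
    ∀ k : ℕ, 1 ≤ k → ∀ g h : Fin k → G, (∀ i, g i ∈ B') → (∀ i, h i ∈ B') →
      g ≠ h → (List.ofFn g).prod ≠ (List.ofFn h).prod

/-- The supremum, over non-empty finite sets `A ⊆ G`, of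
`(∑_{g, h ∈ A} τ_p(g, h)) / (χ_p · #A)`. -/
def normalizedTwoPointSup (S : Finset G) (p : I) : ℝ≥0∞ :=
  ⨆ (A : Finset G) (_ : A.Nonempty),
    (∑ g ∈ A, ∑ h ∈ A, twoPoint (cayley S) p g h) /
      (expectedClusterSize (cayley S) p 1 * (A.card : ℝ≥0∞))

end Group

end Percolation

end

open Percolation

/-!
Split `∑ g, h ∈ A, τ_p(g, h)` according to `g ∈ A'` or not. The points outside `A'` contribute at
most `ε #A χ_p`. A point `a ∈ A'` contributes at most `N` plus the sums of `τ_p(1, ·)` over the two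
sets `H₁`, `H₂` and over `𝒢 D E`, so it suffices that these sums are small multiples of `χ_p` and
that `χ_p → ∞`.

*Branching sets have bounded two-point sums.* Harris' inequality makes `τ_p(1, ·)`
supermultiplicative, so for a set `B'` with distinct products
`(∑ b ∈ B', τ_p(1, b)) ^ k ≤ χ_p` for all `k`; if `χ_p < ∞`, the sum is at most `1`
(`tsum_twoPoint_le_one_of_branching`). Passing to an `r`-neighborhood costs a constant which is
uniform over `p ≥ p₀ > 0` (`exists_tsum_twoPoint_le_of_roughlyBranching`).

*Barriers.* If `B` separates `1` from `H`, exploring the cluster of `1` until it hits `B` shows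
`∑ x ∈ H, τ_p(1, x) ≤ χ_p ∑ b ∈ B, τ_p(1, b)` (`twoPoint_le_tsum_explored`,
`IsBarrier.tsum_twoPoint_le`). For `H ∈ ℋ D`, one of the `D` disjoint barriers carries at most a
`1 / D` fraction of a bounded sum. For `𝒢 D E`, the sum over the barrier is a tail of a sum which
stays bounded up to and including `p_c`, since `τ_p` is lower semicontinuous in `p`; as `τ_p` is also
monotone in `p`, the tail is small uniformly in `p ≤ p_c`.

*Divergence.* If `χ_p < ∞`, then outside a large finite set `K` the sum of `τ_p(1, ·)` is below
`1 / 2`; the expected number of exit points of the cluster from `K` is then below `1 / 2`, which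
depends continuously on the parameter and implies finiteness of the expected cluster size. Hence
`χ < ∞` is an open condition (`eventually_expectedClusterSize_ne_top`), so `χ = ∞` at `p_c`, and
`χ_p → ∞` by lower semicontinuity.

Sharpness of the phase transition (`χ_p < ∞` for `p < p_c`) is not used: where `χ_p = ∞`, the
normalized sums are `0`, being quotients of finite numbers by `∞`.
-/

noncomputable section

namespace Percolation

/-! ### Bernoulli product measures -/

section Product

variable {ι : Type*}

/-- The law of an independent family of `Bool`-valued variables with parameter `p`; for
`ι = Γ.edgeSet` this is definitionally `bondMeasure Γ p`. -/
def bernoulliPi (ι : Type*) (p : I) : Measure (ι → Bool) :=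
  Measure.infinitePi fun _ : ι => bernoulliMeasure true false p

instance (p : I) : IsProbabilityMeasure (bernoulliPi ι p) := by
  unfold bernoulliPi; infer_instance

/-- The sub-σ-algebra generated by the coordinates in `F`. -/
abbrev coordSigma (F : Set ι) : MeasurableSpace (ι → Bool) :=
  ⨆ i ∈ F, MeasurableSpace.comap (fun ω : ι → Bool => ω i) inferInstance

lemma coordSigma_le (F : Set ι) : coordSigma F ≤ MeasurableSpace.pi :=
  iSup₂_le fun i _ => (measurable_pi_apply i).comap_le

lemma measurableSet_coordSigma {F : Set ι} {i : ι} (hi : i ∈ F) (b : Bool) :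
    MeasurableSet[coordSigma F] {ω : ι → Bool | ω i = b} :=
  le_iSup₂ (f := fun i (_ : i ∈ F) =>
    MeasurableSpace.comap (fun ω : ι → Bool => ω i) inferInstance) i hi _
    ⟨{b}, measurableSet_singleton b, rfl⟩

lemma bernoulliPi_inter_of_disjoint (p : I) {F F' : Set ι} (hF : Disjoint F F')
    {E E' : Set (ι → Bool)} (hE : MeasurableSet[coordSigma F] E)
    (hE' : MeasurableSet[coordSigma F'] E') :
    bernoulliPi ι p (E ∩ E') = bernoulliPi ι p E * bernoulliPi ι p E' := by
  have h : iIndepFun (fun (i : ι) (ω : ι → Bool) => ω i) (bernoulliPi ι p) :=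
    iIndepFun_infinitePi (X := fun _ b => b) fun _ => measurable_id
  have := indep_iSup_of_disjoint (m := fun i : ι =>
    MeasurableSpace.comap (fun ω : ι → Bool => ω i) inferInstance)
    (fun i => (measurable_pi_apply i).comap_le) h hF
  exact (Indep_iff _ _ _).1 this E E' hE hE'

/-- The weight of a configuration on finitely many coordinates. -/
def bernoulliWeight {F : Finset ι} (p : I) (η : F → Bool) : ℝ :=
  ∏ i, if η i then (p : ℝ) else 1 - p

lemma bernoulliWeight_nonneg {F : Finset ι} (p : I) (η : F → Bool) :
    0 ≤ bernoulliWeight p η := by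
  refine Finset.prod_nonneg fun i _ => ?_
  split_ifs
  · exact p.2.1
  · linarith [p.2.2]

/-- Extension of a finite configuration by `false`. -/
def extendFalse (F : Finset ι) (η : F → Bool) : ι → Bool := by
  classical exact fun i => if h : i ∈ F then η ⟨i, h⟩ else false

/-- The event `E` is determined by the coordinates in `F`. -/
def DeterminedBy (F : Finset ι) (E : Set (ι → Bool)) : Prop :=
  ∀ ω ω' : ι → Bool, (∀ i ∈ F, ω i = ω' i) → ω ∈ E → ω' ∈ E

lemma DeterminedBy.mono {F F' : Finset ι} {E : Set (ι → Bool)} (h : DeterminedBy F E)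
    (hF : F ⊆ F') : DeterminedBy F' E :=
  fun ω ω' hω => h ω ω' fun i hi => hω i (hF hi)

lemma DeterminedBy.inter {F : Finset ι} {E E' : Set (ι → Bool)} (h : DeterminedBy F E)
    (h' : DeterminedBy F E') : DeterminedBy F (E ∩ E') :=
  fun ω ω' hω hE => ⟨h ω ω' hω hE.1, h' ω ω' hω hE.2⟩

open scoped Classical in
lemma DeterminedBy.measureReal_eq {F : Finset ι} {E : Set (ι → Bool)} (h : DeterminedBy F E)
    (p : I) : (bernoulliPi ι p).real E =
      ∑ η : F → Bool, bernoulliWeight p η * (if extendFalse F η ∈ E then 1 else 0) := by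
  have hcyl : E = cylinder F {η | extendFalse F η ∈ E} := by
    ext ω
    have hω : ∀ i ∈ F, ω i = extendFalse F (F.restrict ω) i := fun i hi => by
      simp [extendFalse, hi]
    exact ⟨h _ _ hω, h _ _ fun i hi => (hω i hi).symm⟩
  have hpi : bernoulliPi ι p E = Measure.pi (fun _ : F => bernoulliMeasure true false p)
      {η | extendFalse F η ∈ E} := by
    conv_lhs => rw [hcyl]
    exact Measure.infinitePi_cylinder _ (Set.toFinite _).measurableSet
  have hsingle : ∀ η : F → Bool,
      (Measure.pi (fun _ : F => bernoulliMeasure true false p)).real {η}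
        = bernoulliWeight p η := by
    intro η
    rw [measureReal_def, Measure.pi_singleton, ENNReal.toReal_prod]
    refine Finset.prod_congr rfl fun i _ => ?_
    rcases η i <;> simp [bernoulliMeasure_def]
  have hset : {η | extendFalse F η ∈ E} =
      ((Finset.univ.filter fun η => extendFalse F η ∈ E : Finset (F → Bool)) : Set _) := by
    ext; simp
  rw [measureReal_def, hpi, ← measureReal_def, hset, ← sum_measureReal_singleton,
    Finset.sum_filter]
  refine Finset.sum_congr rfl fun η _ => ?_
  rw [hsingle]
  split_ifs <;> simp

lemma DeterminedBy.continuous {F : Finset ι} {E : Set (ι → Bool)} (h : DeterminedBy F E) :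
    Continuous fun p : I => bernoulliPi ι p E := by
  have : (fun p : I => bernoulliPi ι p E) =
      fun p : I => ENNReal.ofReal ((bernoulliPi ι p).real E) := by
    funext p; simp [measureReal_def]
  rw [this]
  refine ENNReal.continuous_ofReal.comp ?_
  simp_rw [h.measureReal_eq]
  refine continuous_finsetSum _ fun η _ => Continuous.mul ?_ continuous_const
  refine continuous_finsetProd _ fun i _ => ?_
  split_ifs <;> fun_prop

/-- **Harris' inequality** for increasing events depending on finitely many coordinates. -/
lemma DeterminedBy.mul_le_inter {F : Finset ι} {E E' : Set (ι → Bool)} (h : DeterminedBy F E)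
    (h' : DeterminedBy F E') (hE : IsUpperSet E) (hE' : IsUpperSet E') (p : I) :
    bernoulliPi ι p E * bernoulliPi ι p E' ≤ bernoulliPi ι p (E ∩ E') := by
  classical
  have hmono : ∀ {A : Set (ι → Bool)}, IsUpperSet A →
      Monotone fun η : F → Bool => (if extendFalse F η ∈ A then 1 else 0 : ℝ) := by
    intro A hA η η' hη
    have : extendFalse F η ≤ extendFalse F η' := fun i => by
      unfold extendFalse
      split_ifs
      · exact hη _
      · exact le_rfl
    have := hA this
    dsimp only
    split_ifs <;> simp_all
  have hnn : ∀ {A : Set (ι → Bool)},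
      0 ≤ fun η : F → Bool => (if extendFalse F η ∈ A then 1 else 0 : ℝ) := by
    intro A η
    dsimp only [Pi.zero_apply]
    split_ifs <;> simp
  have key := fkg (μ := bernoulliWeight (F := F) p)
    (f := fun η => if extendFalse F η ∈ E then 1 else 0)
    (g := fun η => if extendFalse F η ∈ E' then 1 else 0) (fun η => bernoulliWeight_nonneg p η)
    (hnn (A := E)) (hnn (A := E')) (hmono hE) (hmono hE') (fun a b => by
      simp only [bernoulliWeight, ← Finset.prod_mul_distrib]
      refine (Finset.prod_congr rfl fun i _ => ?_).le
      rcases ha : a i <;> rcases hb : b i <;> simp [ha, hb, mul_comm])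
  have hone : ∑ η : F → Bool, bernoulliWeight p η = 1 := by
    have : DeterminedBy F (Set.univ : Set (ι → Bool)) := fun _ _ _ _ => trivial
    simpa using (this.measureReal_eq p).symm
  have hmul : ∀ η : F → Bool, (if extendFalse F η ∈ E then 1 else 0 : ℝ) *
      (if extendFalse F η ∈ E' then 1 else 0) = if extendFalse F η ∈ E ∩ E' then 1 else 0 := by
    intro η
    by_cases h1 : extendFalse F η ∈ E <;> by_cases h2 : extendFalse F η ∈ E' <;> simp [h1, h2]
  simp only [hmul] at key
  rw [hone, one_mul, ← h.measureReal_eq, ← h'.measureReal_eq] at key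
  replace key := key.trans_eq ((Finset.sum_congr rfl fun η _ => by congr).trans
    ((h.inter h').measureReal_eq p).symm)
  rw [measureReal_def, measureReal_def, measureReal_def, ← ENNReal.toReal_mul] at key
  exact (ENNReal.toReal_le_toReal (by finiteness) (by finiteness)).1 key

/-- Increasing events become more likely as `p` grows: all the laws are realized at once by
thresholding independent uniform variables. -/
lemma bernoulliPi_mono {E : Set (ι → Bool)} (hm : MeasurableSet E) (hE : IsUpperSet E) {p q : I}
    (hpq : p ≤ q) : bernoulliPi ι p E ≤ bernoulliPi ι q E := by
  have hmeas : ∀ p : I, Measurable fun u : I => decide (u ≤ p) := fun p =>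
    measurable_to_bool (by
      have : (fun u : I => decide (u ≤ p)) ⁻¹' {true} = Set.Iic p := by ext; simp
      rw [this]; exact measurableSet_Iic)
  have hber : ∀ p : I, (volume : Measure I).map (fun u : I => decide (u ≤ p)) =
      bernoulliMeasure true false p := by
    intro p
    refine Measure.ext_of_singleton fun b => ?_
    rw [Measure.map_apply (hmeas p) (measurableSet_singleton b)]
    rcases b with _ | _
    · have : (fun u : I => decide (u ≤ p)) ⁻¹' {false} = Set.Ioi p := by ext; simp
      rw [this, unitInterval.volume_Ioi]
      rw [bernoulliMeasure_apply_of_notMem_of_mem p (measurableSet_singleton _) (by simp) (by simp)]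
      rw [ENNReal.ofReal, Real.toNNReal_of_nonneg (sub_nonneg.2 p.2.2)]
      rfl
    · have : (fun u : I => decide (u ≤ p)) ⁻¹' {true} = Set.Iic p := by ext; simp
      rw [this, unitInterval.volume_Iic]
      rw [bernoulliMeasure_apply_of_mem_of_notMem p (measurableSet_singleton _) (by simp) (by simp)]
      rw [ENNReal.ofReal, Real.toNNReal_of_nonneg p.2.1]
      rfl
  have hmap : ∀ p : I, (Measure.infinitePi fun _ : ι => (volume : Measure I)).map
      (fun u i => decide (u i ≤ p)) = bernoulliPi ι p := by
    intro p
    rw [Measure.infinitePi_map_pi (fun _ : ι => (volume : Measure I)) (fun _ => hmeas p)]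
    simp_rw [hber]
    rfl
  have hmeas' : ∀ p : I, Measurable fun (u : ι → I) (i : ι) => decide (u i ≤ p) := fun p =>
    measurable_pi_lambda _ fun i => (hmeas p).comp (measurable_pi_apply i)
  rw [← hmap p, ← hmap q, Measure.map_apply (hmeas' p) hm, Measure.map_apply (hmeas' q) hm]
  refine measure_mono fun u hu => hE (fun i => ?_) hu
  by_cases h : u i ≤ p
  · simp [h, h.trans hpq]
  · simp [h]

end Product

/-! ### Connection events -/

section Connection

variable {V : Type*} (Γ : SimpleGraph V)

lemma bondMeasure_eq_bernoulliPi (p : I) : bondMeasure Γ p = bernoulliPi Γ.edgeSet p := rfl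

instance (p : I) : IsProbabilityMeasure (bondMeasure Γ p) := by
  rw [bondMeasure_eq_bernoulliPi]; infer_instance

lemma openGraph_adj {ω : Config Γ} {a b : V} :
    (openGraph Γ ω).Adj a b ↔ ∃ h : Γ.Adj a b, ω ⟨s(a, b), h⟩ = true := by
  simp only [openGraph, SimpleGraph.fromEdgeSet_adj, Set.mem_ofPred_eq]
  exact ⟨fun h => h.1, fun h => ⟨h, h.1.ne⟩⟩

/-- `u` is joined to `v` by an open path all of whose (directed) steps `a → b` satisfy `P a b`. -/
def ConnVia (ω : Config Γ) (P : V → V → Prop) : V → V → Prop :=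
  Relation.ReflTransGen fun a b => (openGraph Γ ω).Adj a b ∧ P a b

variable {Γ}

lemma ConnVia.mono {ω ω' : Config Γ} {P P' : V → V → Prop} {u v : V} (h : ConnVia Γ ω P u v)
    (hPP' : ∀ a b, P a b → P' a b)
    (hω : ∀ a b (hab : Γ.Adj a b), P a b → ω ⟨s(a, b), hab⟩ = true → ω' ⟨s(a, b), hab⟩ = true) :
    ConnVia Γ ω' P' u v := by
  refine Relation.ReflTransGen.mono (fun a b hab => ?_) _ _ h
  obtain ⟨h1, h2⟩ := (openGraph_adj Γ).1 hab.1
  exact ⟨(openGraph_adj Γ).2 ⟨h1, hω a b h1 hab.2 h2⟩, hPP' a b hab.2⟩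

lemma ConnVia.reachable {ω : Config Γ} {P : V → V → Prop} {u v : V} (h : ConnVia Γ ω P u v) :
    (openGraph Γ ω).Reachable u v :=
  (SimpleGraph.reachable_iff_reflTransGen u v).2
    (Relation.ReflTransGen.mono (fun _ _ hab => hab.1) _ _ h)

lemma ConnVia.exists_walk {ω : Config Γ} {B : Set V} {u v : V}
    (h : ConnVia Γ ω (fun a _ => a ∉ B) u v) (hv : v ∉ B) :
    ∃ γ : Γ.Walk u v, ∀ g ∈ γ.support, g ∉ B := by
  induction h with
  | refl => exact ⟨.nil, by simpa using hv⟩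
  | tail _ hab ih =>
    obtain ⟨γ, hγ⟩ := ih hab.2
    refine ⟨γ.concat ((openGraph_adj Γ).1 hab.1).1, fun g hg => ?_⟩
    rw [SimpleGraph.Walk.support_concat, List.mem_append,
      List.mem_singleton] at hg
    rcases hg with hg | rfl
    exacts [hγ g hg, hv]

lemma isUpperSet_connVia (P : V → V → Prop) (u v : V) :
    IsUpperSet {ω : Config Γ | ConnVia Γ ω P u v} :=
  fun ω ω' hω h => ConnVia.mono h (fun _ _ h => h) fun a b hab _ h1 => by
    have := hω ⟨s(a, b), hab⟩
    rw [h1] at this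
    exact top_le_iff.1 this

lemma determinedBy_connVia {P : V → V → Prop} {F : Finset Γ.edgeSet}
    (hP : ∀ a b (hab : Γ.Adj a b), P a b → (⟨s(a, b), hab⟩ : Γ.edgeSet) ∈ F) (u v : V) :
    DeterminedBy F {ω : Config Γ | ConnVia Γ ω P u v} :=
  fun ω ω' hω h => ConnVia.mono h (fun _ _ h => h) fun a b hab hPab h1 => by
    rw [← hω _ (hP a b hab hPab), h1]

/-- `v` can be reached from `u` in exactly `n` steps of `R`. -/
def ReachIn (R : V → V → Prop) (u : V) : ℕ → V → Prop
  | 0, v => u = v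
  | n + 1, v => ∃ w, ReachIn R u n w ∧ R w v

lemma reflTransGen_iff_reachIn {R : V → V → Prop} {u v : V} :
    Relation.ReflTransGen R u v ↔ ∃ n, ReachIn R u n v := by
  constructor
  · intro h
    induction h with
    | refl => exact ⟨0, rfl⟩
    | tail _ hab ih => exact ih.imp' (· + 1) fun n hn => ⟨_, hn, hab⟩
  · rintro ⟨n, hn⟩
    induction n generalizing v with
    | zero => exact hn ▸ .refl
    | succ n ih =>
      obtain ⟨w, hw, hwv⟩ := hn
      exact (ih hw).tail hwv

lemma measurableSet_adj {F : Set Γ.edgeSet} {a b : V}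
    (hF : ∀ hab : Γ.Adj a b, (⟨s(a, b), hab⟩ : Γ.edgeSet) ∈ F) :
    MeasurableSet[coordSigma F] {ω : Config Γ | (openGraph Γ ω).Adj a b} := by
  by_cases hab : Γ.Adj a b
  · convert! measurableSet_coordSigma (hF hab) true using 1
    ext ω
    simp [openGraph_adj, hab]
  · convert! @MeasurableSet.empty _ (coordSigma F) using 1
    ext ω
    simp [openGraph_adj, hab]

lemma measurableSet_connVia [Countable V] {P : V → V → Prop} {F : Set Γ.edgeSet}
    (hP : ∀ a b (hab : Γ.Adj a b), P a b → (⟨s(a, b), hab⟩ : Γ.edgeSet) ∈ F) (u v : V) :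
    MeasurableSet[coordSigma F] {ω : Config Γ | ConnVia Γ ω P u v} := by
  have hn : ∀ n v, MeasurableSet[coordSigma F] {ω : Config Γ |
      ReachIn (fun a b => (openGraph Γ ω).Adj a b ∧ P a b) u n v} := by
    intro n
    induction n with
    | zero => exact fun v => @MeasurableSet.const _ (coordSigma F) _
    | succ n ih =>
      intro v
      simp only [ReachIn, Set.ofPred_exists, Set.ofPred_and]
      refine @MeasurableSet.iUnion _ _ (coordSigma F) _ _ fun w =>
        @MeasurableSet.inter _ (coordSigma F) _ _ (ih w) ?_
      by_cases hwv : P w v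
      · exact @MeasurableSet.inter _ (coordSigma F) _ _
          (measurableSet_adj fun h => hP w v h hwv) (@MeasurableSet.const _ (coordSigma F) _)
      · simp only [hwv, Set.ofPred_false, Set.inter_empty]
        exact @MeasurableSet.empty _ (coordSigma F)
  simp only [ConnVia, reflTransGen_iff_reachIn, Set.ofPred_exists]
  exact @MeasurableSet.iUnion _ _ (coordSigma F) _ _ fun n => hn n v

lemma measurableSet_connVia' [Countable V] (P : V → V → Prop) (u v : V) :
    MeasurableSet {ω : Config Γ | ConnVia Γ ω P u v} :=
  coordSigma_le _ _ (measurableSet_connVia (F := Set.univ) (fun _ _ _ _ => trivial) u v)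

lemma reachable_iff_connVia {ω : Config Γ} {u v : V} :
    (openGraph Γ ω).Reachable u v ↔ ConnVia Γ ω (fun _ _ => True) u v := by
  refine ⟨fun h => ?_, ConnVia.reachable⟩
  simpa [ConnVia] using (SimpleGraph.reachable_iff_reflTransGen u v).1 h

lemma measurableSet_reachable [Countable V] (u v : V) :
    MeasurableSet {ω : Config Γ | (openGraph Γ ω).Reachable u v} := by
  simpa only [reachable_iff_connVia] using measurableSet_connVia' _ u v

/-! ### The two-point function -/

/-- The step `a → b` uses an edge of `F`. -/
def StepIn (F : Finset Γ.edgeSet) (a b : V) : Prop :=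
  ∃ h : Γ.Adj a b, (⟨s(a, b), h⟩ : Γ.edgeSet) ∈ F

lemma reachable_iff_exists_stepIn {ω : Config Γ} {u v : V} :
    (openGraph Γ ω).Reachable u v ↔ ∃ F : Finset Γ.edgeSet, ConnVia Γ ω (StepIn F) u v := by
  classical
  refine ⟨fun h => ?_, fun ⟨F, hF⟩ => hF.reachable⟩
  rw [SimpleGraph.reachable_iff_reflTransGen] at h
  induction h with
  | refl => exact ⟨∅, .refl⟩
  | @tail b c _ hab ih =>
    obtain ⟨F, hF⟩ := ih
    have hbc := ((openGraph_adj Γ).1 hab).1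
    refine ⟨insert ⟨s(b, c), hbc⟩ F, Relation.ReflTransGen.tail ?_
      ⟨hab, hbc, Finset.mem_insert_self _ _⟩⟩
    exact hF.mono (fun _ _ ⟨h, h'⟩ => ⟨h, Finset.mem_insert_of_mem h'⟩) fun _ _ _ _ h => h

lemma determinedBy_stepIn (F : Finset Γ.edgeSet) (u v : V) :
    DeterminedBy F {ω : Config Γ | ConnVia Γ ω (StepIn F) u v} :=
  determinedBy_connVia (fun _ _ _ h => h.2) u v

variable (Γ) in
lemma twoPoint_eq_iSup [Countable V] (p : I) (u v : V) :
    twoPoint Γ p u v =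
      ⨆ F : Finset Γ.edgeSet, bondMeasure Γ p {ω | ConnVia Γ ω (StepIn F) u v} := by
  classical
  rw [twoPoint, ← Directed.measure_iUnion]
  · congr 1
    ext ω
    simp [reachable_iff_exists_stepIn]
  · intro F F'
    refine ⟨F ∪ F', fun ω h => ConnVia.mono h ?_ fun _ _ _ _ h => h,
      fun ω h => ConnVia.mono h ?_ fun _ _ _ _ h => h⟩
    · exact fun _ _ ⟨h, h'⟩ => ⟨h, Finset.mem_union_left _ h'⟩
    · exact fun _ _ ⟨h, h'⟩ => ⟨h, Finset.mem_union_right _ h'⟩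

lemma lowerSemicontinuous_twoPoint [Countable V] (u v : V) :
    LowerSemicontinuous fun p : I => twoPoint Γ p u v := by
  simp_rw [twoPoint_eq_iSup]
  exact lowerSemicontinuous_iSup fun F =>
    (determinedBy_stepIn F u v).continuous.lowerSemicontinuous

lemma twoPoint_mono [Countable V] {p q : I} (hpq : p ≤ q) (u v : V) :
    twoPoint Γ p u v ≤ twoPoint Γ q u v := by
  refine bernoulliPi_mono (measurableSet_reachable u v) ?_ hpq
  simpa only [reachable_iff_connVia] using isUpperSet_connVia (fun _ _ => True) u v

lemma twoPoint_mul_le [Countable V] (p : I) (u v w : V) :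
    twoPoint Γ p u v * twoPoint Γ p v w ≤ twoPoint Γ p u w := by
  classical
  rw [twoPoint_eq_iSup Γ p u v, twoPoint_eq_iSup Γ p v w, ENNReal.iSup_mul]
  refine iSup_le fun F => ?_
  rw [ENNReal.mul_iSup]
  refine iSup_le fun F' => ?_
  refine ((((determinedBy_stepIn F u v).mono Finset.subset_union_left).mul_le_inter
    ((determinedBy_stepIn F' v w).mono Finset.subset_union_right)
    (isUpperSet_connVia _ u v) (isUpperSet_connVia _ v w) p)).trans ?_
  exact measure_mono fun ω hω => hω.1.reachable.trans hω.2.reachable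

lemma twoPoint_self (p : I) (u : V) : twoPoint Γ p u u = 1 := by
  simp [twoPoint]

lemma twoPoint_le_one (p : I) (u v : V) : twoPoint Γ p u v ≤ 1 := prob_le_one

lemma le_twoPoint_of_adj (p : I) {u v : V} (h : Γ.Adj u v) :
    ENNReal.ofReal p ≤ twoPoint Γ p u v := by
  have h1 : bondMeasure Γ p {ω | ω ⟨s(u, v), h⟩ = true} = ENNReal.ofReal p := by
    have := Measure.infinitePi_map_eval (fun _ : Γ.edgeSet => bernoulliMeasure true false p)
      ⟨s(u, v), h⟩
    have h2 : ((bondMeasure Γ p).map fun ω => ω ⟨s(u, v), h⟩) {true} =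
        bernoulliMeasure true false p {true} := by rw [← this]; rfl
    rw [Measure.map_apply (measurable_pi_apply _) (measurableSet_singleton _),
      bernoulliMeasure_apply_of_mem_of_notMem p (measurableSet_singleton _)
        (by simp) (by simp)] at h2
    rw [ENNReal.ofReal, Real.toNNReal_of_nonneg p.2.1]
    exact h2
  rw [← h1]
  exact measure_mono fun ω hω => SimpleGraph.Adj.reachable ((openGraph_adj Γ).2 ⟨h, hω⟩)

lemma encard_cluster_eq_tsum (ω : Config Γ) (v : V) : ((cluster Γ ω v).encard : ℝ≥0∞) =
    ∑' w, {ω : Config Γ | (openGraph Γ ω).Reachable v w}.indicator 1 ω := by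
  rw [← ENNReal.tsum_set_one, tsum_subtype (cluster Γ ω v) fun _ => (1 : ℝ≥0∞)]
  rfl

lemma expectedClusterSize_eq_tsum [Countable V] (p : I) (v : V) :
    expectedClusterSize Γ p v = ∑' w, twoPoint Γ p v w := by
  simp_rw [expectedClusterSize, encard_cluster_eq_tsum]
  rw [lintegral_tsum fun w =>
    (measurable_one.indicator (measurableSet_reachable v w)).aemeasurable]
  simp_rw [lintegral_indicator_one (measurableSet_reachable v _)]
  rfl

lemma lowerSemicontinuous_expectedClusterSize [Countable V] (v : V) :
    LowerSemicontinuous fun p : I => expectedClusterSize Γ p v := by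
  simp_rw [expectedClusterSize_eq_tsum]
  exact lowerSemicontinuous_tsum fun w => lowerSemicontinuous_twoPoint v w

lemma ae_finite_cluster [Countable V] {p : I} {v : V} (h : expectedClusterSize Γ p v ≠ ∞) :
    ∀ᵐ ω ∂bondMeasure Γ p, (cluster Γ ω v).Finite := by
  have hm : Measurable fun ω : Config Γ => ((cluster Γ ω v).encard : ℝ≥0∞) := by
    simp_rw [encard_cluster_eq_tsum]
    exact Measurable.tsum fun w => measurable_one.indicator (measurableSet_reachable v w)
  filter_upwards [ae_lt_top hm h] with ω hω
  rw [← Set.encard_lt_top_iff]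
  simpa using hω

/-! ### Exploring a cluster up to a separating set -/

variable (Γ) in
/-- The vertices joined to `u` by an open path which visits `B` at most at its last vertex. -/
def explored (ω : Config Γ) (B : Set V) (u : V) : Set V :=
  {v | ConnVia Γ ω (fun a _ => a ∉ B) u v}

lemma explored_subset_cluster (ω : Config Γ) (B : Set V) (u : V) :
    explored Γ ω B u ⊆ cluster Γ ω u := fun _ h => ConnVia.reachable h

lemma explored_eq_iff {ω : Config Γ} {B K : Set V} {u : V} :
    explored Γ ω B u = K ↔ u ∈ K ∧
      (∀ v ∈ K, ConnVia Γ ω (fun a b => (a ∈ K ∧ a ∉ B) ∧ b ∈ K) u v) ∧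
      ∀ a ∈ K \ B, ∀ b ∉ K, ¬ (openGraph Γ ω).Adj a b := by
  constructor
  · rintro rfl
    refine ⟨.refl, fun v hv => ?_, fun a ha b hb hab => hb (ha.1.tail ⟨hab, ha.2⟩)⟩
    induction hv with
    | refl => exact .refl
    | tail h hab ih => exact ih.tail ⟨hab.1, ⟨h, hab.2⟩, h.tail hab⟩
  · rintro ⟨hu, h1, h2⟩
    ext v
    refine ⟨fun hv => ?_, fun hv => (h1 v hv).mono (fun _ _ h => h.1.2) fun _ _ _ _ h => h⟩
    induction hv with
    | refl => exact hu
    | tail h hab ih =>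
      by_contra hc
      exact h2 _ ⟨ih, hab.2⟩ _ hc hab.1

variable (Γ) in
/-- The edges with an endpoint in `K`. -/
def incidentEdges (K : Set V) : Set Γ.edgeSet := {e | ∃ a ∈ K, a ∈ e.1}

/-- That the explored set is `K` is decided by the edges touching `K \ B`. -/
lemma measurableSet_explored_eq [Countable V] (B K : Set V) (u : V) :
    MeasurableSet[coordSigma (incidentEdges Γ (K \ B))]
      {ω : Config Γ | explored Γ ω B u = K} := by
  simp only [explored_eq_iff, Set.ofPred_and, Set.ofPred_forall]
  let m := coordSigma (incidentEdges Γ (K \ B))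
  refine @MeasurableSet.inter _ m _ _ (@MeasurableSet.const _ m _)
    (@MeasurableSet.inter _ m _ _ ?_ ?_)
  · refine @MeasurableSet.iInter _ _ m _ _ fun v => @MeasurableSet.iInter _ _ m _ _ fun _ => ?_
    refine measurableSet_connVia (fun a b hab h => ?_) u v
    exact ⟨a, h.1, by simp⟩
  · refine @MeasurableSet.iInter _ _ m _ _ fun a => @MeasurableSet.iInter _ _ m _ _ fun ha =>
      @MeasurableSet.iInter _ _ m _ _ fun b => @MeasurableSet.iInter _ _ m _ _ fun _ => ?_
    exact @MeasurableSet.compl _ _ m (measurableSet_adj fun hab => by exact ⟨a, ha, by simp⟩)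

/-- A connection from `u` to a vertex beyond `B` continues from some explored vertex `b ∈ B`
by an open path which never returns to the explored set. -/
lemma exists_connVia_off_explored {ω : Config Γ} {B : Set V} {u x : V}
    (h : (openGraph Γ ω).Reachable u x) :
    (x ∈ explored Γ ω B u ∧ x ∉ B) ∨ ∃ b ∈ explored Γ ω B u ∩ B, ConnVia Γ ω
      (fun a c => (a ∈ explored Γ ω B u → a ∈ B) ∧ c ∉ explored Γ ω B u) b x := by
  rw [SimpleGraph.reachable_iff_reflTransGen] at h
  induction h with
  | refl =>
    by_cases hu : u ∈ B
    · exact .inr ⟨u, ⟨.refl, hu⟩, .refl⟩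
    · exact .inl ⟨.refl, hu⟩
  | @tail y z _ hyz ih =>
    by_cases hz : z ∈ explored Γ ω B u
    · by_cases hzB : z ∈ B
      · exact .inr ⟨z, ⟨hz, hzB⟩, .refl⟩
      · exact .inl ⟨hz, hzB⟩
    · rcases ih with ⟨hy, hyB⟩ | ⟨b, hb, hby⟩
      · exact absurd (hy.tail ⟨hyz, hyB⟩) hz
      · refine .inr ⟨b, hb, hby.tail ⟨hyz, fun hy => ?_, hz⟩⟩
        by_contra hyB
        exact hz (Relation.ReflTransGen.tail hy ⟨hyz, hyB⟩)

/-- If every path from `u` to `x` meets `B`, then `τ(u, x)` is at most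
`∑ b ∈ B, ℙ(b is explored) τ(b, x)`. This plays the role of the van den Berg–Kesten inequality:
conditionally on the explored set, the rest of the connection uses fresh edges. -/
theorem twoPoint_le_tsum_explored [Countable V] (p : I) {B : Set V} {u x : V}
    (hsep : ∀ γ : Γ.Walk u x, ∃ g ∈ γ.support, g ∈ B)
    (hfin : ∀ᵐ ω ∂bondMeasure Γ p, (explored Γ ω B u).Finite) :
    twoPoint Γ p u x ≤ ∑' b, B.indicator (fun b =>
      bondMeasure Γ p {ω | b ∈ explored Γ ω B u} * twoPoint Γ p b x) b := by
  classical
  set μ := bondMeasure Γ p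
  let X : Finset V → Set (Config Γ) := fun K => {ω | explored Γ ω B u = K}
  have hXm : ∀ K, MeasurableSet (X K) := fun K => coordSigma_le _ _
    (measurableSet_explored_eq B (K : Set V) u)
  -- the rest of the connection, which avoids the edges that decide `X K`
  let Y : Finset V → V → Set (Config Γ) := fun K b =>
    {ω | ConnVia Γ ω (fun a c => (a ∈ K → a ∈ B) ∧ c ∉ K) b x}
  have hcover : {ω : Config Γ | (openGraph Γ ω).Reachable u x} ≤ᵐ[μ]
      ⋃ K : Finset V, ⋃ b : V, {ω | b ∈ K ∧ b ∈ B} ∩ (X K ∩ Y K b) := by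
    filter_upwards [hfin] with ω hω hr
    change ω ∈ ⋃ K : Finset V, ⋃ b : V, _
    simp only [Set.mem_iUnion]
    have hK : explored Γ ω B u = hω.toFinset := by simp
    rcases exists_connVia_off_explored (B := B) hr with ⟨h1, h2⟩ | ⟨b, hb, hbx⟩
    · obtain ⟨γ, hγ⟩ := ConnVia.exists_walk h1 h2
      obtain ⟨g, hg, hgB⟩ := hsep γ
      exact absurd hgB (hγ g hg)
    · refine ⟨hω.toFinset, b, ⟨by simpa using hb.1, hb.2⟩, hK, ?_⟩
      simpa [Y] using hbx
  have hterm : ∀ K b, μ ({ω | b ∈ K ∧ b ∈ B} ∩ (X K ∩ Y K b)) ≤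
      B.indicator (fun b => μ {ω | b ∈ K ∧ ω ∈ X K} * twoPoint Γ p b x) b := by
    intro K b
    by_cases hb : b ∈ K ∧ b ∈ B
    · simp only [hb, Set.indicator_of_mem, and_self, Set.ofPred_true, Set.univ_inter, true_and]
      have hind : μ (X K ∩ Y K b) = μ (X K) * μ (Y K b) := by
        refine bernoulliPi_inter_of_disjoint (p := p)
          (disjoint_compl_right (a := incidentEdges Γ ((K : Set V) \ B)))
          (measurableSet_explored_eq B (K : Set V) u) (measurableSet_connVia ?_ b x)
        rintro a c hac ⟨h1, h2⟩ ⟨d, hd, hd'⟩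
        rcases Sym2.mem_iff.1 hd' with rfl | rfl
        · exact hd.2 (h1 hd.1)
        · exact h2 hd.1
      rw [hind]
      exact mul_le_mul_right (measure_mono fun ω hω => ConnVia.reachable hω) _
    · simp [hb]
  calc twoPoint Γ p u x
      ≤ μ (⋃ K : Finset V, ⋃ b : V, {ω | b ∈ K ∧ b ∈ B} ∩ (X K ∩ Y K b)) :=
        measure_mono_ae hcover
    _ ≤ ∑' K : Finset V, ∑' b : V, B.indicator
          (fun b => μ {ω | b ∈ K ∧ ω ∈ X K} * twoPoint Γ p b x) b := by
        refine (measure_iUnion_le _).trans (ENNReal.tsum_le_tsum fun K => ?_)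
        exact (measure_iUnion_le _).trans (ENNReal.tsum_le_tsum fun b => hterm K b)
    _ = ∑' b : V, ∑' K : Finset V, B.indicator
          (fun b => μ {ω | b ∈ K ∧ ω ∈ X K} * twoPoint Γ p b x) b := ENNReal.tsum_comm
    _ ≤ _ := by
        refine ENNReal.tsum_le_tsum fun b => ?_
        by_cases hb : b ∈ B
        · simp only [hb, Set.indicator_of_mem, ENNReal.tsum_mul_right]
          refine mul_le_mul_left ?_ _
          rw [← measure_iUnion]
          · refine measure_mono fun ω hω => ?_
            obtain ⟨K, hK, hω⟩ := Set.mem_iUnion.1 hω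
            change explored Γ ω B u = K at hω
            change b ∈ explored Γ ω B u
            rw [hω]
            exact hK
          · intro K K' hKK'
            refine Set.disjoint_left.2 fun ω h1 h2 => hKK' ?_
            exact Finset.coe_injective (h1.2.symm.trans h2.2)
          · exact fun K => MeasurableSet.inter (.const _) (hXm K)
        · simp [hb]

lemma tsum_twoPoint_le_of_barrier [Countable V] (p : I) {B H : Set V} {u : V} {χ : ℝ≥0∞}
    (hsep : ∀ x ∈ H, ∀ γ : Γ.Walk u x, ∃ g ∈ γ.support, g ∈ B)
    (hfin : expectedClusterSize Γ p u ≠ ∞)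
    (hχ : ∀ b, expectedClusterSize Γ p b ≤ χ) :
    ∑' x, H.indicator (twoPoint Γ p u) x ≤ (∑' b, B.indicator (twoPoint Γ p u) b) * χ := by
  have hf : ∀ᵐ ω ∂bondMeasure Γ p, (explored Γ ω B u).Finite := by
    filter_upwards [ae_finite_cluster hfin] with ω hω
    exact hω.subset (explored_subset_cluster ω B u)
  calc ∑' x, H.indicator (twoPoint Γ p u) x
      ≤ ∑' x, ∑' b, B.indicator (twoPoint Γ p u) b * twoPoint Γ p b x := by
        refine ENNReal.tsum_le_tsum fun x => ?_
        by_cases hx : x ∈ H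
        · rw [Set.indicator_of_mem hx]
          refine (twoPoint_le_tsum_explored p (hsep x hx) hf).trans
            (ENNReal.tsum_le_tsum fun b => ?_)
          by_cases hb : b ∈ B
          · simp only [hb, Set.indicator_of_mem]
            exact mul_le_mul_left (measure_mono fun ω hω => explored_subset_cluster ω B u hω) _
          · simp [hb]
        · simp [hx]
    _ = ∑' b, B.indicator (twoPoint Γ p u) b * expectedClusterSize Γ p b := by
        rw [ENNReal.tsum_comm]
        simp_rw [ENNReal.tsum_mul_left, expectedClusterSize_eq_tsum]
    _ ≤ _ := by
        rw [← ENNReal.tsum_mul_right]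
        exact ENNReal.tsum_le_tsum fun b => mul_le_mul_right (hχ b) _

end Connection

/-! ### Percolation on Cayley graphs -/

section CayleyGraph

variable {G : Type*} [Group G] {S : Finset G}

lemma exists_word (hS : Subgroup.closure (S : Set G) = ⊤) (g : G) :
    ∃ l : List G, (∀ s ∈ l, s ∈ S ∨ s⁻¹ ∈ S) ∧ l.prod = g := by
  have h : g ∈ Submonoid.closure ((S : Set G) ∪ (S : Set G)⁻¹) := by
    rw [← Subgroup.closure_toSubmonoid, hS]
    trivial
  obtain ⟨l, hl, hg⟩ := Submonoid.exists_list_of_mem_closure h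
  exact ⟨l, fun s hs => by simpa using hl s hs, hg⟩

lemma countable_of_closure_eq_top (hS : Subgroup.closure (S : Set G) = ⊤) : Countable G := by
  let L := {s : G // s ∈ (S : Set G) ∪ (S : Set G)⁻¹}
  have : Countable L :=
    (S.countable_toSet.union (S.finite_toSet.inv.countable)).to_subtype
  refine Function.Surjective.countable (f := fun l : List L => (l.map Subtype.val).prod) fun g => ?_
  obtain ⟨l, hl, rfl⟩ := exists_word hS g
  refine ⟨l.attach.map fun s => ⟨s.1, by simpa using hl s.1 s.2⟩, ?_⟩
  simp [List.map_map, Function.comp_def]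

/-- The ball of radius `n` around the identity, as the set of values of words of length `≤ n`. -/
def wordBall (S : Finset G) (n : ℕ) : Set G :=
  {g | ∃ l : List G, l.length ≤ n ∧ (∀ s ∈ l, s ∈ S ∨ s⁻¹ ∈ S) ∧ l.prod = g}

lemma finite_wordBall (n : ℕ) : (wordBall S n).Finite := by
  let L := {s : G // s ∈ (S : Set G) ∪ (S : Set G)⁻¹}
  have : Finite L := (S.finite_toSet.union S.finite_toSet.inv).to_subtype
  refine ((List.finite_length_le L n).image fun l => (l.map Subtype.val).prod).subset ?_
  rintro _ ⟨l, hn, hl, rfl⟩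
  refine ⟨l.attach.map fun s => ⟨s.1, by simpa using hl s.1 s.2⟩, ?_, ?_⟩
  · simpa using hn
  · simp [List.map_map, Function.comp_def]

lemma mem_wordBall_of_wordDist_le (hS : Subgroup.closure (S : Set G) = ⊤) {r : ℝ} {g h : G}
    (hr : (wordDist S g h : ℝ) ≤ r) : g⁻¹ * h ∈ wordBall S ⌊r⌋₊ := by
  have hne : {n : ℕ | ∃ l : List G, l.length = n ∧ (∀ s ∈ l, s ∈ S ∨ s⁻¹ ∈ S) ∧
      h = g * l.prod}.Nonempty := by
    obtain ⟨l, hl, hg⟩ := exists_word hS (g⁻¹ * h)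
    exact ⟨l.length, l, rfl, hl, by simp [hg]⟩
  obtain ⟨l, hn, hl, hg⟩ := Nat.sInf_mem hne
  exact ⟨l, hn.le.trans (Nat.le_floor hr), hl, by simp [hg]⟩

lemma finite_setOf_cayley_adj (a : G) : {b | (cayley S).Adj a b}.Finite := by
  refine ((S.finite_toSet.image (a * ·)).union
    (S.finite_toSet.image fun s => a * s⁻¹)).subset fun b hb => ?_
  obtain ⟨-, s, hs, h | h⟩ := (SimpleGraph.mulCayley_adj' _ _ _).1 hb
  · exact .inl ⟨s, hs, h⟩
  · exact .inr ⟨s, hs, by simp [h]⟩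

lemma finite_incidentEdges {K : Set G} (hK : K.Finite) :
    (incidentEdges (cayley S) K).Finite := by
  have h : (⋃ a ∈ K, (fun b => s(a, b)) '' {b | (cayley S).Adj a b}).Finite :=
    hK.biUnion fun a _ => (finite_setOf_cayley_adj a).image _
  refine (h.preimage (f := Subtype.val) Subtype.val_injective.injOn).subset ?_
  rintro ⟨e, he⟩ ⟨a, ha, hae⟩
  obtain ⟨b, rfl⟩ := Sym2.mem_iff_exists.1 hae
  exact Set.mem_biUnion ha ⟨b, he, rfl⟩

lemma cayley_adj_mul_left {g a b : G} (h : (cayley S).Adj a b) :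
    (cayley S).Adj (g * a) (g * b) := by
  obtain ⟨hne, s, hs, h⟩ := (SimpleGraph.mulCayley_adj' _ _ _).1 h
  refine (SimpleGraph.mulCayley_adj' _ _ _).2 ⟨by simpa using hne, s, hs, ?_⟩
  rcases h with h | h
  · exact .inl (by simp [mul_assoc, h])
  · exact .inr (by simp [mul_assoc, h])

/-- Left multiplication by `g` on the edges of the Cayley graph. -/
def edgeTranslate (S : Finset G) (g : G) (e : (cayley S).edgeSet) : (cayley S).edgeSet :=
  ⟨Sym2.map (g * ·) e.1, by
    obtain ⟨e, he⟩ := e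
    induction e with
    | _ a b => exact cayley_adj_mul_left he⟩

lemma edgeTranslate_injective (g : G) : Function.Injective (edgeTranslate S g) :=
  fun _ _ h => Subtype.ext (Sym2.map.injective (mul_right_injective g) (Subtype.ext_iff.1 h))

variable [Countable G]

lemma twoPoint_mul_left (p : I) (g u v : G) :
    twoPoint (cayley S) p (g * u) (g * v) = twoPoint (cayley S) p u v := by
  have key : ∀ g u v : G,
      twoPoint (cayley S) p u v ≤ twoPoint (cayley S) p (g * u) (g * v) := by
    intro g u v
    have hmap : (bondMeasure (cayley S) p).map (fun ω e => ω (edgeTranslate S g e)) =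
        bondMeasure (cayley S) p :=
      Measure.map_infinitePi_infinitePi_of_inj
        (P := fun _ : (cayley S).edgeSet => bernoulliMeasure true false p)
        (edgeTranslate_injective g)
    rw [twoPoint]
    nth_rewrite 1 [← hmap]
    rw [Measure.map_apply (measurable_pi_lambda _ fun e => measurable_pi_apply _)
      (measurableSet_reachable u v)]
    refine measure_mono fun ω hω => ?_
    have hω' := (SimpleGraph.reachable_iff_reflTransGen u v).1 hω
    refine (SimpleGraph.reachable_iff_reflTransGen _ _).2
      (Relation.ReflTransGen.lift (g * ·) (fun a b hab => ?_) _ _ hω')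
    obtain ⟨h1, h2⟩ := (openGraph_adj _).1 hab
    exact (openGraph_adj _).2 ⟨cayley_adj_mul_left h1, h2⟩
  refine le_antisymm ?_ (key g u v)
  simpa using key g⁻¹ (g * u) (g * v)

lemma twoPoint_eq_one_left (p : I) (u v : G) :
    twoPoint (cayley S) p u v = twoPoint (cayley S) p 1 (u⁻¹ * v) := by
  simpa using (twoPoint_mul_left (S := S) p u 1 (u⁻¹ * v))

lemma expectedClusterSize_eq_one (p : I) (g : G) :
    expectedClusterSize (cayley S) p g = expectedClusterSize (cayley S) p 1 := by
  rw [expectedClusterSize_eq_tsum, expectedClusterSize_eq_tsum,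
    ← (Equiv.mulLeft g).tsum_eq]
  refine tsum_congr fun w => ?_
  simpa using twoPoint_mul_left (S := S) p g 1 w

lemma expectedClusterSize_mono {p q : I} (hpq : p ≤ q) (g : G) :
    expectedClusterSize (cayley S) p g ≤ expectedClusterSize (cayley S) q g := by
  simp_rw [expectedClusterSize_eq_tsum]
  exact ENNReal.tsum_le_tsum fun w => twoPoint_mono hpq g w

/-- The two-point function is supermultiplicative along products. -/
lemma prod_twoPoint_le (p : I) (l : List G) :
    (l.map (twoPoint (cayley S) p 1)).prod ≤ twoPoint (cayley S) p 1 l.prod := by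
  induction l with
  | nil => simp [twoPoint_self]
  | cons a l ih =>
    rw [List.map_cons, List.prod_cons, List.prod_cons]
    refine le_trans (mul_le_mul_right ih _) ?_
    refine le_trans ?_ (twoPoint_mul_le p 1 a (a * l.prod))
    rw [twoPoint_eq_one_left p a]
    simp

lemma pow_length_le_twoPoint (p : I) {l : List G} (hl : ∀ s ∈ l, s ∈ S ∨ s⁻¹ ∈ S) :
    ENNReal.ofReal p ^ l.length ≤ twoPoint (cayley S) p 1 l.prod := by
  refine le_trans ?_ (prod_twoPoint_le p l)
  rw [← List.length_map (f := twoPoint (cayley S) p 1)]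
  refine List.pow_card_le_prod _ _ fun x hx => ?_
  obtain ⟨s, hs, rfl⟩ := List.mem_map.1 hx
  by_cases h1 : s = 1
  · rw [h1, twoPoint_self]
    exact ENNReal.ofReal_le_one.2 p.2.2
  · refine le_twoPoint_of_adj p ((SimpleGraph.mulCayley_adj' _ _ _).2 ⟨Ne.symm h1, ?_⟩)
    rcases hl s hs with h | h
    · exact ⟨s, h, .inl (by simp)⟩
    · exact ⟨s⁻¹, h, .inr (by simp)⟩

lemma twoPoint_ne_zero (hS : Subgroup.closure (S : Set G) = ⊤) {p : I} (hp : 0 < p) (g : G) :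
    twoPoint (cayley S) p 1 g ≠ 0 := by
  obtain ⟨l, hl, rfl⟩ := exists_word hS g
  have hp' : (0 : ℝ) < p := hp
  exact ne_bot_of_le_ne_bot (pow_ne_zero _ (by simpa using hp')) (pow_length_le_twoPoint p hl)

/-! ### Sums of the two-point function over branching sets -/

/-- If products of sequences of a given length from `B` are distinct, then
`(∑ b ∈ B, τ_p(1, b)) ^ k ≤ χ_p` for every `k`, so that the sum is at most `1`. -/
lemma tsum_twoPoint_le_one_of_branching {p : I} (hχ : expectedClusterSize (cayley S) p 1 ≠ ∞)
    {B : Set G} (hB : ∀ k : ℕ, 1 ≤ k → ∀ g h : Fin k → G, (∀ i, g i ∈ B) → (∀ i, h i ∈ B) →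
      g ≠ h → (List.ofFn g).prod ≠ (List.ofFn h).prod) :
    ∑' b, B.indicator (twoPoint (cayley S) p 1) b ≤ 1 := by
  classical
  rw [ENNReal.tsum_eq_iSup_sum]
  refine iSup_le fun F => ?_
  have hF : ∑ b ∈ F, B.indicator (twoPoint (cayley S) p 1) b =
      ∑ b ∈ F.filter (· ∈ B), twoPoint (cayley S) p 1 b := by
    rw [Finset.sum_filter]
    rfl
  rw [hF]
  set x := ∑ b ∈ F.filter (· ∈ B), twoPoint (cayley S) p 1 b with hx
  have hpow : ∀ k : ℕ, 1 ≤ k → x ^ k ≤ expectedClusterSize (cayley S) p 1 := by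
    intro k hk
    have hmem : ∀ g ∈ Fintype.piFinset (fun _ : Fin k => F.filter (· ∈ B)), ∀ i, g i ∈ B :=
      fun g hg i => (Finset.mem_filter.1 (Fintype.mem_piFinset.1 hg i)).2
    calc x ^ k = ∏ _i : Fin k, x := by simp
      _ = ∑ g ∈ Fintype.piFinset (fun _ : Fin k => F.filter (· ∈ B)),
            ∏ i, twoPoint (cayley S) p 1 (g i) := by rw [hx, Finset.prod_univ_sum]
      _ ≤ ∑ g ∈ Fintype.piFinset (fun _ : Fin k => F.filter (· ∈ B)),
            twoPoint (cayley S) p 1 (List.ofFn g).prod := by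
          refine Finset.sum_le_sum fun g _ => ?_
          have := prod_twoPoint_le (S := S) p (List.ofFn g)
          rwa [List.map_ofFn, List.prod_ofFn] at this
      _ = ∑ w ∈ (Fintype.piFinset (fun _ : Fin k => F.filter (· ∈ B))).image
            (fun g => (List.ofFn g).prod), twoPoint (cayley S) p 1 w := by
          rw [Finset.sum_image]
          intro g hg h hh hgh
          by_contra hne
          exact hB k hk g h (hmem g hg) (hmem h hh) hne hgh
      _ ≤ expectedClusterSize (cayley S) p 1 := by
          rw [expectedClusterSize_eq_tsum]
          exact ENNReal.sum_le_tsum _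
  by_contra! h1
  have := ENNReal.tendsto_pow_atTop_nhds_top_iff.2 h1
  obtain ⟨k, hk1, hk2⟩ := ((this.eventually (lt_mem_nhds hχ.lt_top)).and
    (eventually_ge_atTop 1)).exists
  exact absurd (hpow k hk2) hk1.not_ge

/-- Uniformly over `r`-roughly branching sets `B` and over `p ≥ p₀` with `χ_p < ∞`, the sum of
`τ_p(1, b)` over `b ∈ B` is bounded. -/
lemma exists_tsum_twoPoint_le_of_roughlyBranching (hS : Subgroup.closure (S : Set G) = ⊤)
    {p₀ : I} (hp₀ : 0 < p₀) (r : ℝ) :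
    ∃ C : ℝ≥0∞, C ≠ ∞ ∧ ∀ p : I, p₀ ≤ p → expectedClusterSize (cayley S) p 1 ≠ ∞ →
      ∀ B : Set G, IsRoughlyBranching S r B →
        ∑' b, B.indicator (twoPoint (cayley S) p 1) b ≤ C := by
  classical
  set K := (finite_wordBall (S := S) ⌊r⌋₊).toFinset with hK
  refine ⟨∑ s ∈ K, (twoPoint (cayley S) p₀ 1 s⁻¹)⁻¹, ?_, ?_⟩
  · exact ENNReal.sum_ne_top.2 fun s _ => ENNReal.inv_ne_top.2 (twoPoint_ne_zero hS hp₀ _)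
  rintro p hp hχ B ⟨B', hB', hbr⟩
  set f := B'.indicator (twoPoint (cayley S) p 1) with hf
  calc ∑' b, B.indicator (twoPoint (cayley S) p 1) b
      ≤ ∑' b, ∑ s ∈ K, (twoPoint (cayley S) p₀ 1 s⁻¹)⁻¹ * f (b * s⁻¹) := by
        refine ENNReal.tsum_le_tsum fun b => ?_
        by_cases hb : b ∈ B
        · obtain ⟨b', hb', hd⟩ := hB' b hb
          have hs : b'⁻¹ * b ∈ K := by
            rw [hK, Set.Finite.mem_toFinset]
            exact mem_wordBall_of_wordDist_le hS hd
          refine le_trans ?_ (Finset.single_le_sum (f := fun s =>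
            (twoPoint (cayley S) p₀ 1 s⁻¹)⁻¹ * f (b * s⁻¹)) (fun _ _ => zero_le) hs)
          have h0 := twoPoint_ne_zero hS hp₀ (b'⁻¹ * b)⁻¹
          have h1 : twoPoint (cayley S) p₀ 1 (b'⁻¹ * b)⁻¹ ≠ ∞ :=
            ((twoPoint_le_one _ _ _).trans_lt ENNReal.one_lt_top).ne
          have hbs : b * (b'⁻¹ * b)⁻¹ = b' := by group
          simp only [hbs, hf, Set.indicator_of_mem hb, Set.indicator_of_mem hb']
          rw [← ENNReal.mul_le_iff_le_inv h0 h1, mul_comm]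
          refine le_trans (mul_le_mul_right (twoPoint_mono hp _ _) _) ?_
          have := twoPoint_mul_le (Γ := cayley S) p 1 b b'
          rw [twoPoint_eq_one_left p b b'] at this
          simpa using this
        · simp [hb]
    _ = ∑ s ∈ K, (twoPoint (cayley S) p₀ 1 s⁻¹)⁻¹ * ∑' b, f (b * s⁻¹) := by
        rw [Summable.tsum_finsetSum fun _ _ => ENNReal.summable]
        simp_rw [ENNReal.tsum_mul_left]
    _ ≤ ∑ s ∈ K, (twoPoint (cayley S) p₀ 1 s⁻¹)⁻¹ := by
        refine Finset.sum_le_sum fun s _ => ?_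
        have : ∑' b, f (b * s⁻¹) = ∑' b, f b := (Equiv.mulRight s⁻¹).tsum_eq f
        rw [this]
        exact mul_le_of_le_one_right' (tsum_twoPoint_le_one_of_branching hχ hbr)

/-! ### The expected cluster size at criticality -/

/-- A self-consistent bound: if outside the finite set `K` the cluster, explored up to its exit
from `K`, has on average fewer than `1/2` exit points, then `χ_p` is finite. -/
lemma expectedClusterSize_ne_top_of_exit {q : I} (K : Finset G)
    (hfin : ∀ ω, (explored (cayley S) ω (K : Set G)ᶜ 1).Finite)
    (hφ : ∑' b, (K : Set G)ᶜ.indicator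
      (fun b => bondMeasure (cayley S) q {ω | b ∈ explored (cayley S) ω (K : Set G)ᶜ 1}) b
        ≤ 2⁻¹) :
    expectedClusterSize (cayley S) q 1 ≠ ∞ := by
  classical
  have hbound : ∀ F : Finset G,
      ∑ y ∈ F, twoPoint (cayley S) q 1 y ≤ 2 * K.card := by
    intro F
    -- the supremum over all finite sets of the same size absorbs the translations
    let X : ℝ≥0∞ := ⨆ F' : {F' : Finset G // F'.card ≤ F.card},
      ∑ y ∈ F'.1, twoPoint (cayley S) q 1 y
    have hXtop : X ≠ ∞ := by
      refine ne_top_of_le_ne_top (ENNReal.natCast_ne_top F.card) (iSup_le fun F' => ?_)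
      refine (Finset.sum_le_sum fun y _ => twoPoint_le_one q 1 y).trans ?_
      simpa using F'.2
    have hXb : ∀ (F' : Finset G), F'.card ≤ F.card → ∀ b,
        ∑ y ∈ F', twoPoint (cayley S) q b y ≤ X := by
      intro F' hF' b
      have h1 : ∑ y ∈ F', twoPoint (cayley S) q b y =
          ∑ y ∈ F'.image (b⁻¹ * ·), twoPoint (cayley S) q 1 y := by
        rw [Finset.sum_image fun _ _ _ _ h => mul_left_cancel h]
        exact Finset.sum_congr rfl fun y _ => twoPoint_eq_one_left q b y
      rw [h1]
      exact le_iSup (fun F' : {F' : Finset G // F'.card ≤ F.card} =>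
        ∑ y ∈ F'.1, twoPoint (cayley S) q 1 y) ⟨_, Finset.card_image_le.trans hF'⟩
    have hX : X ≤ K.card + 2⁻¹ * X := by
      refine iSup_le fun ⟨F', hF'⟩ => ?_
      rw [← Finset.sum_filter_add_sum_filter_not F' (· ∈ K)]
      gcongr
      · refine (Finset.sum_le_sum fun y _ => twoPoint_le_one q 1 y).trans ?_
        simp only [Finset.sum_const, nsmul_eq_mul, mul_one, Nat.cast_le]
        exact Finset.card_le_card fun y hy => (Finset.mem_filter.1 hy).2
      · calc ∑ y ∈ F' with y ∉ K, twoPoint (cayley S) q 1 y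
            ≤ ∑ y ∈ F' with y ∉ K, ∑' b, (K : Set G)ᶜ.indicator (fun b =>
                bondMeasure (cayley S) q {ω | b ∈ explored (cayley S) ω (K : Set G)ᶜ 1} *
                  twoPoint (cayley S) q b y) b := by
              refine Finset.sum_le_sum fun y hy => ?_
              exact twoPoint_le_tsum_explored q
                (fun γ => ⟨y, γ.end_mem_support, by simpa using (Finset.mem_filter.1 hy).2⟩)
                (ae_of_all _ hfin)
          _ = ∑' b, ∑ y ∈ F' with y ∉ K, (K : Set G)ᶜ.indicator (fun b =>
                bondMeasure (cayley S) q {ω | b ∈ explored (cayley S) ω (K : Set G)ᶜ 1}) b *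
                  twoPoint (cayley S) q b y := by
              rw [← Summable.tsum_finsetSum fun _ _ => ENNReal.summable]
              refine tsum_congr fun b => Finset.sum_congr rfl fun y _ => ?_
              exact Set.indicator_mul_left _ _ _
          _ ≤ ∑' b, (K : Set G)ᶜ.indicator (fun b =>
                bondMeasure (cayley S) q {ω | b ∈ explored (cayley S) ω (K : Set G)ᶜ 1}) b *
                  X := by
              refine ENNReal.tsum_le_tsum fun b => ?_
              rw [← Finset.mul_sum]
              exact mul_le_mul_right
                (hXb _ ((Finset.card_le_card (Finset.filter_subset _ _)).trans hF') b) _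
          _ ≤ 2⁻¹ * X := by
              rw [ENNReal.tsum_mul_right]
              exact mul_le_mul_left hφ _
    have hX2 : X ≤ 2 * K.card := by
      have h2 : X = 2⁻¹ * X + 2⁻¹ * X := by
        rw [← add_mul, ENNReal.inv_two_add_inv_two, one_mul]
      have h3 : 2⁻¹ * X ≤ K.card := by
        have h4 : 2⁻¹ * X + 2⁻¹ * X ≤ K.card + 2⁻¹ * X := h2 ▸ hX
        exact (ENNReal.add_le_add_iff_right
          (ENNReal.mul_ne_top (by simp) hXtop)).1 h4
      calc X = 2 * (2⁻¹ * X) := by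
            rw [← mul_assoc, ENNReal.mul_inv_cancel (by simp) (by simp), one_mul]
        _ ≤ _ := mul_le_mul_right h3 _
    exact (by simpa using hXb F le_rfl 1 : _ ≤ X).trans hX2
  rw [expectedClusterSize_eq_tsum, ENNReal.tsum_eq_iSup_sum]
  exact ne_top_of_le_ne_top (by finiteness) (iSup_le hbound)

/-- Finiteness of `χ_p` is an open condition on `p`. -/
lemma eventually_expectedClusterSize_ne_top {p : I}
    (hp : expectedClusterSize (cayley S) p 1 ≠ ∞) :
    ∀ᶠ q in 𝓝 p, expectedClusterSize (cayley S) q 1 ≠ ∞ := by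
  classical
  rw [expectedClusterSize_eq_tsum] at hp
  obtain ⟨K, hK⟩ := ((tendsto_order.1 (ENNReal.tendsto_tsum_compl_atTop_zero hp)).2 2⁻¹
    (by simp)).exists
  set B : Set G := (K : Set G)ᶜ with hB
  -- the explored set stays in the union of `K`, its outer boundary and the root
  have hN : (insert 1 (⋃ a ∈ K, {b | (cayley S).Adj a b})).Finite :=
    (K.finite_toSet.biUnion fun a _ => finite_setOf_cayley_adj a).insert 1
  have hsub : ∀ ω, explored (cayley S) ω B 1 ⊆
      insert 1 (⋃ a ∈ K, {b | (cayley S).Adj a b}) := by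
    intro ω v hv
    rcases Relation.ReflTransGen.cases_tail hv with h | ⟨w, -, hwv⟩
    · exact .inl h
    · refine .inr (Set.mem_biUnion (x := w) ?_ ((openGraph_adj _).1 hwv.1).1)
      simpa [hB] using hwv.2
  have hφ : ∀ q, ∑' b, B.indicator
      (fun b => bondMeasure (cayley S) q {ω | b ∈ explored (cayley S) ω B 1}) b =
      ∑ b ∈ hN.toFinset, B.indicator
      (fun b => bondMeasure (cayley S) q {ω | b ∈ explored (cayley S) ω B 1}) b := by
    intro q
    refine tsum_eq_sum fun b hb => ?_
    have : {ω | b ∈ explored (cayley S) ω B 1} = ∅ := by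
      ext ω
      simp only [Set.mem_empty_iff_false, iff_false]
      exact fun h => hb ((Set.Finite.mem_toFinset hN).2 (hsub ω h))
    simp [Set.indicator, this]
  have hcont : Continuous fun q => ∑ b ∈ hN.toFinset, B.indicator
      (fun b => bondMeasure (cayley S) q {ω | b ∈ explored (cayley S) ω B 1}) b := by
    refine continuous_finsetSum _ fun b _ => ?_
    by_cases hb : b ∈ B
    · simp only [hb, Set.indicator_of_mem]
      refine (determinedBy_connVia (F := (finite_incidentEdges K.finite_toSet).toFinset)
        (fun a c hac ha => ?_) 1 b).continuous
      rw [Set.Finite.mem_toFinset]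
      exact ⟨a, by simpa [hB] using ha, by simp⟩
    · simp only [hb, not_false_eq_true, Set.indicator_of_notMem]
      exact continuous_const
  have hlt : ∑ b ∈ hN.toFinset, B.indicator
      (fun b => bondMeasure (cayley S) p {ω | b ∈ explored (cayley S) ω B 1}) b < 2⁻¹ := by
    rw [← hφ]
    refine lt_of_le_of_lt ?_ hK
    refine le_trans ?_ (tsum_subtype (K : Set G)ᶜ (twoPoint (cayley S) p 1)).ge
    refine ENNReal.tsum_le_tsum fun b => Set.indicator_le_indicator ?_
    exact measure_mono fun ω hω => explored_subset_cluster ω B 1 hω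
  filter_upwards [(hcont.tendsto p).eventually (gt_mem_nhds hlt)] with q hq
  refine expectedClusterSize_ne_top_of_exit K (fun ω => hN.subset (hsub ω)) ?_
  rw [hφ]
  exact hq.le

/-- Otherwise `χ` would be finite throughout a neighborhood of `p_c`, where, by definition of `p_c`,
there are parameters with infinite clusters. -/
lemma expectedClusterSize_criticalParameter [Infinite G]
    (hS : Subgroup.closure (S : Set G) = ⊤) :
    expectedClusterSize (cayley S) (criticalParameter (cayley S) 1) 1 = ∞ := by
  by_contra hne
  -- at `p = 1` all edges are open and the Cayley graph is infinite and connected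
  have hone : (1 : I) ∈
      {p : I | 0 < bondMeasure (cayley S) p {ω | (cluster (cayley S) ω 1).Infinite}} := by
    have hτ : ∀ g, twoPoint (cayley S) (1 : I) 1 g = 1 := by
      intro g
      obtain ⟨l, hl, rfl⟩ := exists_word hS g
      exact le_antisymm (twoPoint_le_one _ _ _) (by simpa using pow_length_le_twoPoint 1 hl)
    have hae : ∀ᵐ ω ∂bondMeasure (cayley S) 1, ∀ g, g ∈ cluster (cayley S) ω 1 :=
      ae_all_iff.2 fun g => (prob_compl_eq_zero_iff (measurableSet_reachable 1 g)).2 (hτ g)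
    have hinf : ∀ᵐ ω ∂bondMeasure (cayley S) 1, (cluster (cayley S) ω 1).Infinite := by
      filter_upwards [hae] with ω hω
      rw [Set.eq_univ_of_forall hω]
      exact Set.infinite_univ
    rw [Set.mem_ofPred_eq, pos_iff_ne_zero]
    intro h0
    obtain ⟨ω, hω, hω'⟩ := (hinf.and (measure_eq_zero_iff_ae_notMem.1 h0)).exists
    exact hω' hω
  obtain ⟨q, hq, hqmem⟩ := (mem_closure_iff_nhds.1 (csInf_mem_closure ⟨_, hone⟩
    (OrderBot.bddBelow _)) _ (eventually_expectedClusterSize_ne_top hne))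
  have := ae_finite_cluster hq
  rw [ae_iff] at this
  exact hqmem.ne' this

end CayleyGraph

/-! ### Barriers and the normalized two-point sum -/

section Barriers

variable {G : Type*} [Group G] {S : Finset G} [Countable G]

/-- The two-point sum over a set behind a barrier `B` is at most `χ_p ∑ b ∈ B, τ_p(1, b)`. -/
lemma IsBarrier.tsum_twoPoint_le {p : I} (hχ : expectedClusterSize (cayley S) p 1 ≠ ∞)
    {B H : Set G} (h : IsBarrier S B {1} H) :
    ∑' x, H.indicator (twoPoint (cayley S) p 1) x ≤
      (∑' b, B.indicator (twoPoint (cayley S) p 1) b) * expectedClusterSize (cayley S) p 1 :=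
  tsum_twoPoint_le_of_barrier p (fun x hx γ => h 1 rfl x hx γ) hχ
    fun b => (expectedClusterSize_eq_one p b).le

/-- Among `D` disjoint barriers, whose union has total two-point sum at most `D η`, one has
two-point sum at most `η`. -/
lemma tsum_twoPoint_le_of_disjoint_barriers {p : I}
    (hχ : expectedClusterSize (cayley S) p 1 ≠ ∞) {D : ℕ} (hD : 1 ≤ D) {H : Set G}
    {B : Fin D → Set G} (hdisj : ∀ i j, i ≠ j → Disjoint (B i) (B j))
    (hbar : ∀ i, IsBarrier S (B i) {1} H) {η : ℝ≥0∞}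
    (hη : ∑' b, (⋃ i, B i).indicator (twoPoint (cayley S) p 1) b ≤ D * η) :
    ∑' x, H.indicator (twoPoint (cayley S) p 1) x ≤
      η * expectedClusterSize (cayley S) p 1 := by
  have hsum : ∑ i, ∑' b, (B i).indicator (twoPoint (cayley S) p 1) b ≤ ∑ _i : Fin D, η := by
    rw [← Summable.tsum_finsetSum fun _ _ => ENNReal.summable]
    refine le_trans (ENNReal.tsum_le_tsum fun b => ?_) (hη.trans_eq (by simp))
    have := Finset.indicator_biUnion_apply Finset.univ B (f := twoPoint (cayley S) p 1)
      (fun i _ j _ hij => hdisj i j hij) b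
    simp only [Finset.mem_univ, Set.iUnion_true] at this
    exact this.ge
  have : Nonempty (Fin D) := ⟨⟨0, hD⟩⟩
  obtain ⟨i, hi⟩ : ∃ i, ∑' b, (B i).indicator (twoPoint (cayley S) p 1) b ≤ η := by
    by_contra! hlt
    exact absurd hsum (ENNReal.sum_lt_sum_of_nonempty Finset.univ_nonempty
      fun i _ => hlt i).not_ge
  exact ((hbar i).tsum_twoPoint_le hχ).trans (mul_le_mul_left hi _)

/-- If almost all of `A`, seen from `a`, lies in the union of `H₁`, `H₂` and `H₃`, then the
two-point sum over `A` is controlled by the two-point sums over these sets. -/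
lemma sum_twoPoint_le_of_ncard_le (p : I) (A : Finset G) (a : G) {H₁ H₂ H₃ : Set G} {N : ℕ}
    (hN : ((A : Set G) \ (a • (H₁ ∪ H₂ ∪ H₃))).ncard ≤ N) {c₁ c₂ c₃ : ℝ≥0∞}
    (h₁ : ∑' x, H₁.indicator (twoPoint (cayley S) p 1) x ≤ c₁)
    (h₂ : ∑' x, H₂.indicator (twoPoint (cayley S) p 1) x ≤ c₂)
    (h₃ : ∑' x, H₃.indicator (twoPoint (cayley S) p 1) x ≤ c₃) :
    ∑ h ∈ A, twoPoint (cayley S) p a h ≤ N + (c₁ + c₂ + c₃) := by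
  classical
  have hshift : ∀ H : Set G, ∑ h ∈ A, H.indicator (twoPoint (cayley S) p 1) (a⁻¹ * h) ≤
      ∑' x, H.indicator (twoPoint (cayley S) p 1) x := fun H => by
    rw [← (Equiv.mulLeft a⁻¹).tsum_eq (H.indicator (twoPoint (cayley S) p 1))]
    exact ENNReal.sum_le_tsum A
  have hcount : ∑ h ∈ A, (if h ∈ a • (H₁ ∪ H₂ ∪ H₃) then 0 else 1 : ℝ≥0∞) ≤ N := by
    have hset : ((A : Set G) \ (a • (H₁ ∪ H₂ ∪ H₃))) =
        ((A.filter (· ∉ a • (H₁ ∪ H₂ ∪ H₃)) : Finset G) : Set G) := by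
      ext; simp
    rw [hset, Set.ncard_coe_finset] at hN
    calc _ = ∑ h ∈ A, (if h ∉ a • (H₁ ∪ H₂ ∪ H₃) then 1 else 0 : ℝ≥0∞) :=
          Finset.sum_congr rfl fun h _ => by split_ifs <;> simp_all
      _ ≤ N := by
          rw [Finset.sum_boole]
          exact_mod_cast hN
  calc ∑ h ∈ A, twoPoint (cayley S) p a h
      ≤ ∑ h ∈ A, ((if h ∈ a • (H₁ ∪ H₂ ∪ H₃) then 0 else 1) +
          (H₁.indicator (twoPoint (cayley S) p 1) (a⁻¹ * h) +
            H₂.indicator (twoPoint (cayley S) p 1) (a⁻¹ * h) +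
            H₃.indicator (twoPoint (cayley S) p 1) (a⁻¹ * h))) := by
        refine Finset.sum_le_sum fun h _ => ?_
        by_cases hh : h ∈ a • (H₁ ∪ H₂ ∪ H₃)
        · rw [if_pos hh, zero_add, twoPoint_eq_one_left p a h]
          rw [Set.mem_smul_set_iff_inv_smul_mem, smul_eq_mul] at hh
          rcases hh with (hh | hh) | hh
          · rw [Set.indicator_of_mem hh]
            exact le_self_add.trans le_self_add
          · rw [Set.indicator_of_mem (s := H₂) hh]
            exact (le_add_self (α := ℝ≥0∞)).trans le_self_add
          · rw [Set.indicator_of_mem (s := H₃) hh]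
            exact le_add_self
        · rw [if_neg hh]
          exact (twoPoint_le_one p a h).trans le_self_add
    _ ≤ _ := by
        simp only [Finset.sum_add_distrib]
        gcongr
        exacts [(hshift H₁).trans h₁, (hshift H₂).trans h₂, (hshift H₃).trans h₃]

end Barriers

/-! ### Tails of sums over disjoint sets -/

section Tail

variable {G : Type*}

/-- The tails of a summable family over disjoint sets `T i`, `i ≥ 1`, tend to zero. -/
lemma exists_tsum_indicator_tail_le {T : ℕ → Set G}
    (hT : ∀ i j, 1 ≤ i → 1 ≤ j → i ≠ j → Disjoint (T i) (T j)) {f : G → ℝ≥0∞}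
    (hf : ∑' b, (⋃ (i : ℕ) (_ : 1 ≤ i), T i).indicator f b ≠ ∞) {η : ℝ≥0∞} (hη : 0 < η) :
    ∃ E : ℕ, 1 ≤ E ∧ ∑' b, (⋃ (i : ℕ) (_ : E ≤ i), T i).indicator f b ≤ η := by
  classical
  set U := ⋃ (i : ℕ) (_ : 1 ≤ i), T i with hU
  obtain ⟨F, hF⟩ := ((tendsto_order.1 (ENNReal.tendsto_tsum_compl_atTop_zero hf)).2 η hη).exists
  have hindex : ∀ b, ∃ n : ℕ, ∀ i, 1 ≤ i → b ∈ T i → i ≤ n := by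
    intro b
    by_cases hb : ∃ i, 1 ≤ i ∧ b ∈ T i
    · obtain ⟨i, hi, hbi⟩ := hb
      refine ⟨i, fun j hj hbj => ?_⟩
      by_contra hne
      exact Set.disjoint_left.1 (hT i j hi hj (by omega)) hbi hbj
    · exact ⟨0, fun i hi hbi => absurd ⟨i, hi, hbi⟩ hb⟩
  -- past `F.sup n` the sets `T i` no longer meet `F`
  choose n hn using hindex
  refine ⟨F.sup n + 1, by omega, le_trans ?_ hF.le⟩
  refine le_trans ?_ (tsum_subtype (F : Set G)ᶜ (U.indicator f)).ge
  refine ENNReal.tsum_le_tsum fun b => ?_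
  by_cases hb : b ∈ ⋃ (i : ℕ) (_ : F.sup n + 1 ≤ i), T i
  · obtain ⟨i, hi, hbi⟩ := Set.mem_iUnion₂.1 hb
    have hbU : b ∈ U := Set.mem_iUnion₂.2 ⟨i, by omega, hbi⟩
    have hbF : b ∈ (F : Set G)ᶜ := fun hbF => by
      have h1 := hn b i (by omega) hbi
      have h2 : n b ≤ F.sup n := Finset.le_sup hbF
      omega
    rw [Set.indicator_of_mem hb, Set.indicator_of_mem hbF, Set.indicator_of_mem hbU]
  · rw [Set.indicator_of_notMem hb]
    exact zero_le

end Tail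

/-! ### The limit at the critical parameter -/

section Limit

variable {G : Type*} [Group G] {S : Finset G}

/-- A finite sum divided by `∞` is `0`. -/
lemma normalizedTwoPointSup_eq_zero {p : I} (h : expectedClusterSize (cayley S) p 1 = ∞) :
    normalizedTwoPointSup S p = 0 := by
  refine le_antisymm (iSup₂_le fun A hA => ?_) zero_le
  rw [h, ENNReal.top_mul (by simpa using hA.ne_empty)]
  simp

/-- If for a proportion `1 - ε` of the `a ∈ A` the two-point sum over `A` seen from `a` is at most
`4 ε χ_p`, then the normalized sum is at most `5 ε`: the other points contribute at most `χ_p`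
each. -/
lemma sum_twoPoint_div_le [Countable G] {p : I} {ε : ℝ}
    {A A' : Finset G} (hA' : A' ⊆ A)
    (hcard : (1 - ε) * (A.card : ℝ) ≤ (A'.card : ℝ))
    (h : ∀ a ∈ A', ∑ b ∈ A, twoPoint (cayley S) p a b ≤
      4 * ENNReal.ofReal ε * expectedClusterSize (cayley S) p 1) :
    (∑ a ∈ A, ∑ b ∈ A, twoPoint (cayley S) p a b) /
      (expectedClusterSize (cayley S) p 1 * (A.card : ℝ≥0∞)) ≤ 5 * ENNReal.ofReal ε := by
  classical
  set χ := expectedClusterSize (cayley S) p 1 with hχ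
  refine ENNReal.div_le_of_le_mul ?_
  rw [← Finset.sum_sdiff hA']
  have hdiff : ((A \ A').card : ℝ≥0∞) ≤ ENNReal.ofReal ε * A.card := by
    have h1 : ((A \ A').card : ℝ) + A'.card = A.card := by
      exact_mod_cast Finset.card_sdiff_add_card_eq_card hA'
    have h2 : ((A \ A').card : ℝ) ≤ ε * A.card := by linarith
    have h3 := ENNReal.ofReal_le_ofReal h2
    rwa [ENNReal.ofReal_mul' (Nat.cast_nonneg _), ENNReal.ofReal_natCast,
      ENNReal.ofReal_natCast] at h3
  have hbad : ∑ a ∈ A \ A', ∑ b ∈ A, twoPoint (cayley S) p a b ≤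
      ENNReal.ofReal ε * A.card * χ := by
    calc _ ≤ ∑ _a ∈ A \ A', χ := by
          refine Finset.sum_le_sum fun a _ => ?_
          rw [hχ, ← expectedClusterSize_eq_one p a, expectedClusterSize_eq_tsum]
          exact ENNReal.sum_le_tsum A
      _ ≤ _ := by
          rw [Finset.sum_const, nsmul_eq_mul]
          exact mul_le_mul_left hdiff _
  have hgood : ∑ a ∈ A', ∑ b ∈ A, twoPoint (cayley S) p a b ≤
      A.card * (4 * ENNReal.ofReal ε * χ) := by
    calc _ ≤ ∑ _a ∈ A', 4 * ENNReal.ofReal ε * χ := Finset.sum_le_sum h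
      _ ≤ _ := by
          rw [Finset.sum_const, nsmul_eq_mul]
          exact mul_le_mul_left (by exact_mod_cast Finset.card_le_card hA') _
  refine (add_le_add hbad hgood).trans_eq ?_
  ring

/-- `χ_p` diverges at `p_c`, by lower semicontinuity and its infinite value there. -/
lemma tendsto_expectedClusterSize [Countable G] [Infinite G]
    (hS : Subgroup.closure (S : Set G) = ⊤) :
    Tendsto (fun p : I => expectedClusterSize (cayley S) p 1)
      (𝓝 (criticalParameter (cayley S) 1)) (𝓝 ∞) := by
  refine tendsto_order.2 ⟨fun c hc => ?_, fun c hc => absurd hc not_top_lt⟩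
  refine lowerSemicontinuous_expectedClusterSize (Γ := cayley S) 1 _ c ?_
  simpa only [expectedClusterSize_criticalParameter hS] using hc

/-- A bound for `∑ b ∈ B, τ_p(1, b)` for `p < p_c` persists at `p_c`. -/
lemma tsum_twoPoint_le_of_forall_lt [Countable G] {p₀ q : I} (hp₀ : p₀ < q) {B : Set G}
    {C : ℝ≥0∞} (h : ∀ p, p₀ ≤ p → p < q → ∑' b, B.indicator (twoPoint (cayley S) p 1) b ≤ C) :
    ∑' b, B.indicator (twoPoint (cayley S) q 1) b ≤ C := by
  by_contra! hC
  have hlsc : LowerSemicontinuous fun p : I =>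
      ∑' b, B.indicator (twoPoint (cayley S) p 1) b := by
    refine lowerSemicontinuous_tsum fun b => ?_
    by_cases hb : b ∈ B
    · simpa only [Set.indicator_of_mem hb] using lowerSemicontinuous_twoPoint 1 b
    · simpa only [Set.indicator_of_notMem hb] using lowerSemicontinuous_const
  have hne : (𝓝[<] q).NeBot := nhdsLT_neBot_of_exists_lt ⟨p₀, hp₀⟩
  have hev : ∀ᶠ p in 𝓝[<] q, C < ∑' b, B.indicator (twoPoint (cayley S) p 1) b :=
    nhdsWithin_le_nhds (hlsc q C hC)
  obtain ⟨p, hp1, hp2, hp3⟩ := (hev.and (Ioo_mem_nhdsLT hp₀)).exists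
  exact absurd (h p hp2.le hp3) hp1.not_ge

end Limit

end Percolation

end

theorem mainTheorem10 {G : Type*} [Group G] [Infinite G]
    (S : Finset G) (hS : Subgroup.closure (S : Set G) = ⊤)
    (r : ℝ) (hr : 0 < r)
    (T : ℕ → ℕ → Set G) (𝒢 : ℕ → ℕ → Set G) (ℋ : ℕ → Set (Set G))
    (hT_disjoint : ∀ D, 1 ≤ D → ∀ i j, 1 ≤ i → 1 ≤ j → i ≠ j → Disjoint (T D i) (T D j))
    (hT_branching : ∀ D, 1 ≤ D →
      ∃ r' : ℝ, IsRoughlyBranching S r' (⋃ (i : ℕ) (_ : 1 ≤ i), T D i))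
    (hℋ : ∀ D, 1 ≤ D → ∀ H ∈ ℋ D,
      ∃ B : Fin D → Set G,
        (∀ i j, i ≠ j → Disjoint (B i) (B j)) ∧
        IsRoughlyBranching S r (⋃ i, B i) ∧
        ∀ i, IsBarrier S (B i) {1} H)
    (h𝒢 : ∀ D E, 1 ≤ D → 1 ≤ E →
      IsBarrier S (⋃ (i : ℕ) (_ : E ≤ i), T D i) {1} (𝒢 D E))
    (hmagic : ∀ ε : ℝ, 0 < ε → ∀ D E : ℕ, 1 ≤ D → 1 ≤ E →
      ∃ N : ℕ, ∀ A : Finset G, ∃ A' : Finset G, A' ⊆ A ∧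
        (1 - ε) * (A.card : ℝ) ≤ (A'.card : ℝ) ∧
        ∀ a ∈ A', ∃ H₁ ∈ ℋ D, ∃ H₂ ∈ ℋ D,
          ((A : Set G) \ (a • (H₁ ∪ H₂ ∪ 𝒢 D E))).ncard ≤ N) :
    Tendsto (fun p : I => normalizedTwoPointSup S p)
      (𝓝[<] criticalParameter (cayley S) 1) (𝓝 0) := by
  classical
  have : Countable G := countable_of_closure_eq_top hS
  set pc := criticalParameter (cayley S) 1 with hpc
  -- `χ_p = ∞` at some `p < p_c` would, by monotonicity, make the sums vanish from there on
  by_cases htop : ∃ q < pc, expectedClusterSize (cayley S) q 1 = ∞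
  · obtain ⟨q, hq, hqtop⟩ := htop
    refine Tendsto.congr' (f₁ := fun _ => 0) ?_ tendsto_const_nhds
    filter_upwards [Ioo_mem_nhdsLT hq] with p hp
    refine (normalizedTwoPointSup_eq_zero (top_le_iff.1 ?_)).symm
    rw [← hqtop]
    exact expectedClusterSize_mono hp.1.le 1
  push Not at htop
  -- if `p_c = 0`, then no parameter lies below it and the limit is along the trivial filter
  by_cases hbot : ∃ p₀ : I, 0 < p₀ ∧ p₀ < pc
  swap
  · have : 𝓝[<] pc = ⊥ := by
      have h0 : pc = 0 := by
        by_contra h0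
        exact hbot (exists_between (pos_iff_ne_zero.2 h0))
      have : Set.Iio pc = ∅ := by
        rw [h0]
        exact Set.eq_empty_of_forall_notMem fun x hx => not_lt_zero (Set.mem_Iio.1 hx)
      rw [this, nhdsWithin_empty]
    rw [this]
    exact tendsto_bot
  obtain ⟨p₀, hp₀, hp₀c⟩ := hbot
  -- `D` makes one of `D` disjoint barriers light, and `E` makes the tail of the `T D i` light
  obtain ⟨C, hC, hCB⟩ := exists_tsum_twoPoint_le_of_roughlyBranching hS hp₀ r
  rw [ENNReal.tendsto_nhds_zero]
  intro δ hδ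
  -- three light sets, the remaining `N` elements and the part `A \ A'` each contribute `η`
  obtain ⟨ε, hε, hεδ⟩ : ∃ ε : ℝ, 0 < ε ∧ 5 * ENNReal.ofReal ε ≤ δ := by
    have h1 : 0 < min δ 1 := lt_min hδ one_pos
    have h2 : min δ 1 ≠ ∞ := ne_top_of_le_ne_top ENNReal.one_ne_top (min_le_right _ _)
    refine ⟨(min δ 1).toReal / 5, div_pos (ENNReal.toReal_pos h1.ne' h2) (by norm_num), ?_⟩
    rw [ENNReal.ofReal_div_of_pos (by norm_num), ENNReal.ofReal_toReal h2,
      ENNReal.ofReal_ofNat, ENNReal.mul_div_cancel (by simp) (by simp)]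
    exact min_le_left _ _
  set η := ENNReal.ofReal ε with hη
  have hη0 : 0 < η := ENNReal.ofReal_pos.2 hε
  obtain ⟨D, hD, hCD⟩ : ∃ D : ℕ, 1 ≤ D ∧ C ≤ D * η := by
    obtain ⟨D, hD⟩ := ENNReal.exists_nat_mul_gt hη0.ne' hC
    refine ⟨D + 1, by omega, hD.le.trans (mul_le_mul_left ?_ _)⟩
    push_cast
    exact le_self_add
  obtain ⟨r', hr'⟩ := hT_branching D hD
  obtain ⟨C', hC', hCB'⟩ := exists_tsum_twoPoint_le_of_roughlyBranching hS hp₀ r'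
  obtain ⟨E, hE, htail⟩ := exists_tsum_indicator_tail_le (hT_disjoint D hD)
    (f := twoPoint (cayley S) pc 1) (ne_top_of_le_ne_top hC'
      (tsum_twoPoint_le_of_forall_lt hp₀c fun p hp hpc => hCB' p hp (htop p hpc) _ hr')) hη0
  obtain ⟨N, hN⟩ := hmagic ε hε D E hD hE
  -- the at most `N` remaining elements are negligible because `χ_p → ∞`
  have hlarge : ∀ᶠ p in 𝓝[<] pc, N / η < expectedClusterSize (cayley S) p 1 :=
    ((tendsto_expectedClusterSize hS).mono_left nhdsWithin_le_nhds).eventually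
      (lt_mem_nhds (ENNReal.div_lt_top (ENNReal.natCast_ne_top N) hη0.ne'))
  filter_upwards [Ioo_mem_nhdsLT hp₀c, hlarge] with p hp hNχ
  have hχ := htop p hp.2
  set χ := expectedClusterSize (cayley S) p 1 with hχdef
  have hNle : (N : ℝ≥0∞) ≤ η * χ := by
    rw [mul_comm]
    exact (ENNReal.div_le_iff_le_mul (.inl hη0.ne') (.inl ENNReal.ofReal_ne_top)).1 hNχ.le
  have hHsum : ∀ H ∈ ℋ D, ∑' x, H.indicator (twoPoint (cayley S) p 1) x ≤ η * χ := by
    intro H hH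
    obtain ⟨B, hB1, hB2, hB3⟩ := hℋ D hD H hH
    exact tsum_twoPoint_le_of_disjoint_barriers hχ hD hB1 hB3
      ((hCB p hp.1.le hχ _ hB2).trans hCD)
  have hGsum : ∑' x, (𝒢 D E).indicator (twoPoint (cayley S) p 1) x ≤ η * χ := by
    refine ((h𝒢 D E hD hE).tsum_twoPoint_le hχ).trans (mul_le_mul_left (le_trans ?_ htail) _)
    exact ENNReal.tsum_le_tsum fun b =>
      Set.indicator_le_indicator (twoPoint_mono hp.2.le 1 b)
  refine (iSup₂_le fun A hA => ?_ : normalizedTwoPointSup S p ≤ 5 * η).trans hεδ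
  obtain ⟨A', hA', hcard, hA'H⟩ := hN A
  refine sum_twoPoint_div_le hA' hcard fun a ha => ?_
  obtain ⟨H₁, h₁, H₂, h₂, hle⟩ := hA'H a ha
  refine (sum_twoPoint_le_of_ncard_le p A a hle (hHsum _ h₁) (hHsum _ h₂) hGsum).trans ?_
  refine (add_le_add_left hNle _).trans_eq ?_
  ring
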